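/- Notation: $(a;q)_n=\prod_{i=0}^{n-1}(1-aq^i)$ and $(a;q)_\infty=\lim_{n\to\infty}(a;q)_n$. (1) Let $q$ be a complex number with $|q|<1$. Then $$\sum_{n=1}^{\infty}\frac{q^n}{(-q^n;q)_{n+1}\,(-q^{2n+2};q^2)_\infty}=\sum_{j=0}^{\infty}(-1)^j q^{6j^2+4j+1}\bigl(1+q^{4j+2}\bigr),$$ where, for every $n\ge 1$, the infinite product converges and the denominator is nonzero, and both series converge absolutely. (2) Let $n\ge 1$. Among the partitions of $n$ in which each odd part is less than twice the smallest part, let $d_o(n)$ be the number of those with an odd number of parts and $d_e(n)$ the number of those with an even number of parts (parts being counted with multiplicity). Then $$d_o(n)-d_e(n)=\begin{cases}(-1)^j, & \text{if } n=6j^2+4j+1 \text{ or } n=6j^2+8j+3 \text{ for some integer } j\ge 0,\\ 0, & \text{otherwise.}\end{cases}$$ -/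

import Mathlib

/-- The finite `q`-shifted factorial `(a;q)_n = (1 - a)(1 - aq) ⋯ (1 - aq^(n-1))`. -/
noncomputable def qPoch (a q : ℂ) (n : ℕ) : ℂ :=
  ∏ i ∈ Finset.range n, (1 - a * q ^ i)

/-- The infinite `q`-shifted factorial `(a;q)_∞ = lim_{n → ∞} (a;q)_n`. -/
noncomputable def qPochInf (a q : ℂ) : ℂ :=
  Filter.limUnder Filter.atTop (fun n : ℕ => qPoch a q n)

/-- The smallest part of a partition (of a positive integer). -/
noncomputable def smallestPart {n : ℕ} (p : n.Partition) : ℕ :=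
  sInf {i : ℕ | i ∈ p.parts}

/-- Each odd part of `p` is less than twice the smallest part of `p`. -/
def OddPartsLtTwiceSmallest {n : ℕ} (p : n.Partition) : Prop :=
  ∀ i ∈ p.parts, Odd i → i < 2 * smallestPart p

open Classical in
/-- `d_o(n)`: the number of partitions of `n` in which each odd part is less than twice the
smallest part, having an odd number of parts (counted with multiplicity). -/
noncomputable def dOdd (n : ℕ) : ℕ :=
  {p : n.Partition | OddPartsLtTwiceSmallest p ∧ Odd (Multiset.card p.parts)}.toFinset.card

open Classical in
/-- `d_e(n)`: the number of partitions of `n` in which each odd part is less than twice the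
smallest part, having an even number of parts (counted with multiplicity). -/
noncomputable def dEven (n : ℕ) : ℕ :=
  {p : n.Partition | OddPartsLtTwiceSmallest p ∧ Even (Multiset.card p.parts)}.toFinset.card

/-- The denominator `(-q^n;q)_{n+1} (-q^(2n+2);q²)_∞`. -/
noncomputable def pentDenom (q : ℂ) (n : ℕ) : ℂ :=
  qPoch (-q ^ n) q (n + 1) * qPochInf (-q ^ (2 * n + 2)) (q ^ 2)

open Filter Topology

/-! ### Shifted factorials -/

/-! For the analytic identity, write `F(w)` for `paramSeries q w`; the left side is `F(1)`. Each
identification compares two bounded solutions of one first-order recurrence, whose difference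
vanishes by `eq_zero_of_bounded_recurrence`. Telescoping gives `(1 + wq) F(w) = q + q F(wq²)`, a
recurrence also satisfied by `q` times Fine's series with base `q²`, `b = -wq`, `t = q`. Fine's
series on the line `b = -t = -x` and Rogers' series with both parameters `x²` share a recurrence
under `x ↦ xq`. Rogers' series along `d = q^(4j+1)`, `y = q^(2j+1)` shares one with the tails of the
false theta series. Composing the three evaluates `F(1)`.

For the partitions, sort by the smallest part `m` and remove one copy of it: the sign flips, and
what remains is any partition into parts from `admissibleParts m`, with signed generating function
`1 / pentDenom q m`. Hence the left side generates `d_o(n) - d_e(n)`. Signed counts are bounded by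
`2^n`, so everything converges absolutely for `‖q‖ < 1/2`, which suffices to compare coefficients
with the false theta series. -/

theorem qPoch_succ (a q : ℂ) (n : ℕ) : qPoch a q (n + 1) = qPoch a q n * (1 - a * q ^ n) :=
  Finset.prod_range_succ _ _

theorem qPoch_succ' (a q : ℂ) (n : ℕ) : qPoch a q (n + 1) = (1 - a) * qPoch (a * q) q n := by
  unfold qPoch
  rw [Finset.prod_range_succ', mul_comm]
  congr 1
  · simp
  · exact Finset.prod_congr rfl fun i _ => by ring

theorem summable_norm_mul_pow (a : ℂ) {q : ℂ} (hq : ‖q‖ < 1) :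
    Summable fun i : ℕ => ‖-(a * q ^ i)‖ := by
  simp only [norm_neg, norm_mul, norm_pow]
  exact (summable_geometric_of_lt_one (norm_nonneg _) hq).mul_left _

theorem tendsto_qPoch (a : ℂ) {q : ℂ} (hq : ‖q‖ < 1) :
    Tendsto (fun n : ℕ => qPoch a q n) atTop (𝓝 (qPochInf a q)) := by
  have h := (multipliable_one_add_of_summable (summable_norm_mul_pow a hq)).hasProd.tendsto_prod_nat
  have h' : Tendsto (fun n : ℕ => qPoch a q n) atTop (𝓝 (∏' i : ℕ, (1 + -(a * q ^ i)))) := by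
    simpa only [qPoch, sub_eq_add_neg] using h
  rwa [qPochInf, h'.limUnder_eq]

theorem qPochInf_eq_mul (a : ℂ) {q : ℂ} (hq : ‖q‖ < 1) :
    qPochInf a q = (1 - a) * qPochInf (a * q) q := by
  refine tendsto_nhds_unique ((tendsto_add_atTop_iff_nat 1).2 (tendsto_qPoch a hq)) ?_
  simp only [qPoch_succ']
  exact (tendsto_qPoch _ hq).const_mul _

/-- Finite shifted factorials with small arguments are uniformly bounded away from zero. -/
theorem exists_le_norm_qPoch {r : ℝ} (h0 : 0 ≤ r) (h1 : r < 1) :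
    ∃ c : ℝ, 0 < c ∧ ∀ (a p : ℂ) (n : ℕ), ‖a‖ ≤ r → ‖p‖ ≤ r → c ≤ ‖qPoch a p n‖ := by
  have hs : Summable fun i : ℕ => ‖-(r * r ^ i)‖ := by
    simp only [norm_neg, norm_mul, norm_pow]
    exact (summable_geometric_of_lt_one (norm_nonneg _)
      (by rwa [Real.norm_of_nonneg h0])).mul_left _
  have hlt : ∀ i : ℕ, r * r ^ i < 1 := fun i => by
    rw [← pow_succ']; exact pow_lt_one₀ h0 h1 (by simp)
  have hne := tprod_one_add_ne_zero_of_summable (f := fun i : ℕ => -(r * r ^ i))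
    (fun i => by have := hlt i; intro h; linarith) hs
  have ht := (multipliable_one_add_of_summable hs).hasProd.tendsto_prod_nat
  set P := ∏' i : ℕ, (1 + -(r * r ^ i))
  have hnn : ∀ i : ℕ, 0 ≤ 1 + -(r * r ^ i) := fun i => by linarith [hlt i]
  have hanti : Antitone fun n => ∏ i ∈ Finset.range n, (1 + -(r * r ^ i)) := by
    refine antitone_nat_of_succ_le fun n => ?_
    rw [Finset.prod_range_succ]
    refine mul_le_of_le_one_right (Finset.prod_nonneg fun i _ => hnn i) ?_
    have : 0 ≤ r * r ^ n := by positivity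
    linarith
  have hP : 0 ≤ P := ge_of_tendsto' ht fun n => Finset.prod_nonneg fun i _ => hnn i
  refine ⟨P, lt_of_le_of_ne hP hne.symm, fun a p n ha hp => ?_⟩
  refine (hanti.le_of_tendsto ht n).trans ?_
  rw [qPoch, norm_prod]
  refine Finset.prod_le_prod (fun i _ => hnn i) fun i _ => ?_
  have h2 : ‖a * p ^ i‖ ≤ r * r ^ i := by
    rw [norm_mul, norm_pow]; gcongr
  have h3 := norm_sub_norm_le (1 : ℂ) (a * p ^ i)
  rw [norm_one] at h3
  linarith

/-- The bound does not depend on `n`, so it still applies when the length of the product grows while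
`a` tends to zero. -/
theorem norm_qPoch_sub_one_le {r : ℝ} (h1 : r < 1) {a p : ℂ} (hp : ‖p‖ ≤ r) (n : ℕ) :
    ‖qPoch a p n - 1‖ ≤ Real.exp (‖a‖ * (1 - r)⁻¹) - 1 := by
  have h0 : 0 ≤ r := (norm_nonneg p).trans hp
  have h := Finset.norm_prod_one_add_sub_one_le (Finset.range n) (fun i => -(a * p ^ i))
  simp only [← sub_eq_add_neg] at h
  refine h.trans (sub_le_sub_right (Real.exp_le_exp.2 ?_) _)
  calc ∑ i ∈ Finset.range n, ‖-(a * p ^ i)‖ ≤ ∑ i ∈ Finset.range n, ‖a‖ * r ^ i := by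
        refine Finset.sum_le_sum fun i _ => ?_
        rw [norm_neg, norm_mul, norm_pow]; gcongr
    _ ≤ ‖a‖ * (1 - r)⁻¹ := by
        rw [← Finset.mul_sum, ← tsum_geometric_of_lt_one h0 h1]
        gcongr
        exact (summable_geometric_of_lt_one h0 h1).sum_le_tsum _ fun _ _ => by positivity

/-! ### Auxiliary facts on series and recurrences -/

theorem summable_div_of_le {r c : ℝ} (h0 : 0 ≤ r) (h1 : r < 1) (hc : 0 < c) {a d : ℕ → ℂ}
    (ha : ∀ n, ‖a n‖ ≤ r ^ n) (hd : ∀ n, c ≤ ‖d n‖) :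
    Summable (fun n => a n / d n) ∧ ‖∑' n, a n / d n‖ ≤ (1 - r)⁻¹ * c⁻¹ := by
  have hg := (hasSum_geometric_of_lt_one h0 h1).mul_right c⁻¹
  have hb : ∀ n, ‖a n / d n‖ ≤ r ^ n * c⁻¹ := fun n => by
    rw [norm_div, div_eq_mul_inv]
    have := ha n
    have := hd n
    gcongr
  exact ⟨Summable.of_norm_bounded hg.summable hb, tsum_of_norm_bounded hg hb⟩

/-- Beyond some `K` the factors `c k` have norm below a fixed `ρ < 1`; iterating the recurrence
against the bound `M` forces `u` to vanish there. Earlier factors may have norm at least 1, but the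
recurrence carries the zero back from `K` to 0. -/
theorem eq_zero_of_bounded_recurrence {u c : ℕ → ℂ} {l : ℂ} {M : ℝ} (hu : ∀ k, ‖u k‖ ≤ M)
    (hrec : ∀ k, u k = c k * u (k + 1)) (hc : Tendsto c atTop (𝓝 l)) (hl : ‖l‖ < 1) :
    u 0 = 0 := by
  obtain ⟨ρ, hlρ, hρ⟩ := exists_between hl
  have hρ0 : 0 ≤ ρ := (norm_nonneg l).trans hlρ.le
  obtain ⟨K, hK⟩ := eventually_atTop.1 (hc.norm.eventually_lt_const hlρ)
  have hpow : ∀ j k, K ≤ k → ‖u k‖ ≤ ρ ^ j * M := by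
    intro j
    induction j with
    | zero => intro k _; simpa using hu k
    | succ j ih =>
      intro k hk
      rw [hrec, norm_mul, pow_succ', mul_assoc]
      have := ih (k + 1) (by omega)
      have := (hK k hk).le
      gcongr
  have hKz : u K = 0 := by
    have ht : Tendsto (fun j : ℕ => ρ ^ j * M) atTop (𝓝 (0 * M)) :=
      (tendsto_pow_atTop_nhds_zero_of_lt_one hρ0 hρ).mul_const M
    rw [zero_mul] at ht
    exact norm_le_zero_iff.1 (ge_of_tendsto' ht fun j => hpow j K le_rfl)
  have hdown : ∀ i, i ≤ K → u (K - i) = 0 := by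
    intro i
    induction i with
    | zero => intro _; simpa using hKz
    | succ i ih =>
      intro hi
      rw [hrec, show K - (i + 1) + 1 = K - i by omega, ih (by omega), mul_zero]
  simpa using hdown K le_rfl

/-! ### The two auxiliary series -/

/-- Fine's series `∑ t^k / (b;q)_{k+1}`. -/
noncomputable def fineSeries (q b t : ℂ) : ℂ := ∑' k : ℕ, t ^ k / qPoch b q (k + 1)

/-- The partial-theta type series `∑ (-c)^n q^(n²) / (y;q²)_{n+1}`. -/
noncomputable def rogersSeries (q c y : ℂ) : ℂ :=
  ∑' n : ℕ, ((-c) ^ n * q ^ n ^ 2) / qPoch y (q ^ 2) (n + 1)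

/-- `c` is a uniform positive lower bound for `‖(a;p)_n‖`, where `‖a‖, ‖p‖ ≤ r < 1`. -/
structure IsPochBound (r c : ℝ) : Prop where
  nonneg : 0 ≤ r
  lt_one : r < 1
  pos : 0 < c
  le_norm : ∀ (a p : ℂ) (n : ℕ), ‖a‖ ≤ r → ‖p‖ ≤ r → c ≤ ‖qPoch a p n‖

/-! ### Functional equations of the Fine and Rogers series -/

namespace IsPochBound

variable {r c : ℝ}

theorem ne_zero (H : IsPochBound r c) {a p : ℂ} (ha : ‖a‖ ≤ r) (hp : ‖p‖ ≤ r) (n : ℕ) :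
    qPoch a p n ≠ 0 :=
  norm_pos_iff.1 (H.pos.trans_le (H.le_norm a p n ha hp))

theorem one_sub_ne_zero (H : IsPochBound r c) {a : ℂ} (ha : ‖a‖ ≤ r) : 1 - a ≠ 0 := by
  intro h
  have : a = 1 := (sub_eq_zero.1 h).symm
  rw [this, norm_one] at ha
  linarith [H.lt_one]

theorem norm_mul_le (H : IsPochBound r c) {a b : ℂ} (ha : ‖a‖ ≤ r) (hb : ‖b‖ ≤ r) :
    ‖a * b‖ ≤ r := by
  rw [norm_mul]
  calc ‖a‖ * ‖b‖ ≤ r * 1 := by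
        have := H.lt_one.le
        have := H.nonneg
        gcongr
        linarith
    _ = r := mul_one r

theorem norm_pow_le (H : IsPochBound r c) {a : ℂ} (ha : ‖a‖ ≤ r) {n : ℕ} (hn : n ≠ 0) :
    ‖a ^ n‖ ≤ r := by
  rw [norm_pow]
  exact (pow_le_pow_left₀ (norm_nonneg a) ha n).trans (pow_le_of_le_one H.nonneg H.lt_one.le hn)

theorem fineSeries_summable (H : IsPochBound r c) {q b t : ℂ} (hq : ‖q‖ ≤ r) (hb : ‖b‖ ≤ r)
    (ht : ‖t‖ ≤ r) :
    Summable (fun k : ℕ => t ^ k / qPoch b q (k + 1)) ∧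
      ‖fineSeries q b t‖ ≤ (1 - r)⁻¹ * c⁻¹ :=
  summable_div_of_le H.nonneg H.lt_one H.pos
    (fun n => by rw [norm_pow]; gcongr) (fun n => H.le_norm _ _ _ hb hq)

theorem rogersSeries_summable (H : IsPochBound r c) {q d y : ℂ} (hq : ‖q‖ ≤ r) (hd : ‖d‖ ≤ r)
    (hy : ‖y‖ ≤ r) :
    Summable (fun n : ℕ => ((-d) ^ n * q ^ n ^ 2) / qPoch y (q ^ 2) (n + 1)) ∧
      ‖rogersSeries q d y‖ ≤ (1 - r)⁻¹ * c⁻¹ :=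
  summable_div_of_le H.nonneg H.lt_one H.pos
    (fun n => by
      rw [norm_mul, norm_pow, norm_pow, norm_neg]
      calc ‖d‖ ^ n * ‖q‖ ^ n ^ 2 ≤ r ^ n * 1 := by
            have := H.nonneg
            gcongr
            exact pow_le_one₀ (norm_nonneg _) (hq.trans H.lt_one.le)
        _ = r ^ n := mul_one _)
    (fun n => H.le_norm _ _ _ hy (H.norm_pow_le hq two_ne_zero))

theorem fineSeries_eq_left (H : IsPochBound r c) {q b t : ℂ} (hq : ‖q‖ ≤ r) (hb : ‖b‖ ≤ r)
    (ht : ‖t‖ ≤ r) : (1 - b) * fineSeries q b t = 1 + t * fineSeries q (b * q) t := by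
  have hb1 := H.one_sub_ne_zero hb
  unfold fineSeries
  rw [(H.fineSeries_summable hq hb ht).1.tsum_eq_zero_add, mul_add, ← tsum_mul_left,
    ← tsum_mul_left]
  congr 1
  · simp [qPoch, hb1]
  · refine tsum_congr fun k => ?_
    rw [qPoch_succ' b q (k + 1)]
    have := H.ne_zero (H.norm_mul_le hb hq) hq (k + 1)
    field_simp
    try ring

/-- In `fineSeries q b t - b * fineSeries q b (t * q)` the `k`-th numerator acquires the factor `1 -
b q^k`, which cancels the last factor of the denominator; what is left is the original series
shifted by one index. -/
theorem fineSeries_eq_right (H : IsPochBound r c) {q b t : ℂ} (hq : ‖q‖ ≤ r) (hb : ‖b‖ ≤ r)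
    (ht : ‖t‖ ≤ r) : (1 - t) * fineSeries q b t = 1 + b * fineSeries q b (t * q) := by
  have hS := (H.fineSeries_summable hq hb ht).1
  have hS' := (H.fineSeries_summable hq hb (H.norm_mul_le ht hq)).1
  have key : fineSeries q b t - b * fineSeries q b (t * q) = 1 + t * fineSeries q b t := by
    unfold fineSeries
    rw [← tsum_mul_left, ← tsum_mul_left, ← hS.tsum_sub (hS'.mul_left b),
      (hS.sub (hS'.mul_left b)).tsum_eq_zero_add]
    congr 1
    · have hb1 := H.one_sub_ne_zero hb
      simp only [qPoch, zero_add, Finset.prod_range_one, pow_zero, mul_one]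
      field_simp
    · refine tsum_congr fun k => ?_
      rw [qPoch_succ b q (k + 1)]
      have h2 := H.ne_zero hb hq (k + 1)
      have h3 : 1 - b * q ^ (k + 1) ≠ 0 :=
        H.one_sub_ne_zero (H.norm_mul_le hb (H.norm_pow_le hq k.succ_ne_zero))
      field_simp
      ring
  linear_combination key

/-- Moving `b` and `t` together preserves the relation `b = -t`, on which the comparison with
Rogers' series takes place. -/
theorem fineSeries_step (H : IsPochBound r c) {q b t : ℂ} (hq : ‖q‖ ≤ r) (hb : ‖b‖ ≤ r)
    (ht : ‖t‖ ≤ r) : (1 - t) * (1 - b) * fineSeries q b t =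
      1 + b * t * q * fineSeries q (b * q) (t * q) := by
  linear_combination (1 - t) * H.fineSeries_eq_left hq hb ht +
    t * H.fineSeries_eq_right hq (H.norm_mul_le hb hq) ht

theorem rogersSeries_eq_shift (H : IsPochBound r c) {q d y : ℂ} (hq : ‖q‖ ≤ r) (hd : ‖d‖ ≤ r)
    (hy : ‖y‖ ≤ r) :
    (1 - y) * rogersSeries q d y = 1 - d * q * rogersSeries q (d * q ^ 2) (y * q ^ 2) := by
  have hy1 := H.one_sub_ne_zero hy
  have hq2 := H.norm_pow_le hq two_ne_zero
  unfold rogersSeries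
  rw [(H.rogersSeries_summable hq hd hy).1.tsum_eq_zero_add, mul_add,
    sub_eq_add_neg (1 : ℂ) (d * q * _), ← neg_mul, ← tsum_mul_left, ← tsum_mul_left]
  congr 1
  · simp [qPoch, hy1]
  · refine tsum_congr fun k => ?_
    rw [qPoch_succ' y (q ^ 2) (k + 1)]
    have := H.ne_zero (H.norm_mul_le hy hq2) hq2 (k + 1)
    field_simp
    ring

/-- As for Fine's series: subtracting `y` times the series at `d q²` creates the factor `1 - y
q^(2n)`, which shortens each denominator by one. -/
theorem rogersSeries_eq_right (H : IsPochBound r c) {q d y : ℂ} (hq : ‖q‖ ≤ r) (hd : ‖d‖ ≤ r)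
    (hy : ‖y‖ ≤ r) :
    rogersSeries q d y = 1 + (y - d * q) * rogersSeries q (d * q ^ 2) y := by
  have hq2 := H.norm_pow_le hq two_ne_zero
  have hS := (H.rogersSeries_summable hq hd hy).1
  have hS' := (H.rogersSeries_summable hq (H.norm_mul_le hd hq2) hy).1
  have key : rogersSeries q d y - y * rogersSeries q (d * q ^ 2) y =
      1 + (-(d * q)) * rogersSeries q (d * q ^ 2) y := by
    unfold rogersSeries
    rw [← tsum_mul_left, ← tsum_mul_left, ← hS.tsum_sub (hS'.mul_left y),
      (hS.sub (hS'.mul_left y)).tsum_eq_zero_add]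
    congr 1
    · have hy1 := H.one_sub_ne_zero hy
      simp only [qPoch, zero_add, Finset.prod_range_one, pow_zero, mul_one, ne_eq,
        OfNat.ofNat_ne_zero, not_false_eq_true, zero_pow]
      field_simp
    · refine tsum_congr fun k => ?_
      rw [qPoch_succ y (q ^ 2) (k + 1)]
      have h2 := H.ne_zero hy hq2 (k + 1)
      have h3 : 1 - y * (q ^ 2) ^ (k + 1) ≠ 0 :=
        H.one_sub_ne_zero (H.norm_mul_le hy (H.norm_pow_le hq2 k.succ_ne_zero))
      field_simp
      ring
  linear_combination key

/-- The combined move `(d, y) ↦ (d q⁴, y q²)` preserves the relation `d q = y²`. -/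
theorem rogersSeries_step (H : IsPochBound r c) {q d y : ℂ} (hq : ‖q‖ ≤ r) (hd : ‖d‖ ≤ r)
    (hy : ‖y‖ ≤ r) :
    (1 - y) * rogersSeries q d y =
      1 - d * q - d * q ^ 3 * (y - d * q) * rogersSeries q (d * q ^ 4) (y * q ^ 2) := by
  have hq2 := H.norm_pow_le hq two_ne_zero
  have h := H.rogersSeries_eq_right hq (H.norm_mul_le hd hq2) (H.norm_mul_le hy hq2)
  rw [show d * q ^ 2 * q ^ 2 = d * q ^ 4 by ring] at h
  linear_combination H.rogersSeries_eq_shift hq hd hy - d * q * h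

end IsPochBound

/-! ### The basic series with an extra parameter -/

/-- The denominator `(-w q^n;q)_{n+1} (-w q^(2n+2);q²)_∞`. -/
noncomputable def paramDenom (q w : ℂ) (n : ℕ) : ℂ :=
  qPoch (-(w * q ^ n)) q (n + 1) * qPochInf (-(w * q ^ (2 * n + 2))) (q ^ 2)

/-- The series `∑ q^n / ((-w q^n;q)_{n+1} (-w q^(2n+2);q²)_∞)` over `n ≥ 1`. -/
noncomputable def paramSeries (q w : ℂ) : ℂ :=
  ∑' n : ℕ, q ^ (n + 1) / paramDenom q w (n + 1)

theorem paramDenom_one (q : ℂ) (n : ℕ) : paramDenom q 1 n = pentDenom q n := by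
  simp [paramDenom, pentDenom]

theorem paramDenom_succ {q : ℂ} (hq : ‖q‖ < 1) (w : ℂ) (m : ℕ) :
    paramDenom q w m * (1 + w * q ^ (2 * m + 1)) =
      paramDenom q w (m + 1) * (1 + w * q ^ m) := by
  have hq2 : ‖q ^ 2‖ < 1 := by
    rw [norm_pow]; exact pow_lt_one₀ (norm_nonneg _) hq two_ne_zero
  unfold paramDenom
  rw [qPoch_succ' (-(w * q ^ m)) q m, qPoch_succ _ q (m + 1), qPoch_succ _ q m,
    qPochInf_eq_mul (-(w * q ^ (2 * m + 2))) hq2,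
    show -(w * q ^ m) * q = -(w * q ^ (m + 1)) by ring,
    show -(w * q ^ (2 * m + 2)) * q ^ 2 = -(w * q ^ (2 * (m + 1) + 2)) by ring]
  ring

theorem paramDenom_succ_eq (q w : ℂ) (m : ℕ) :
    paramDenom q w (m + 1) = (1 + w * q ^ (m + 1)) * paramDenom q (w * q ^ 2) m := by
  unfold paramDenom
  rw [qPoch_succ' _ q (m + 1), show -(w * q ^ (m + 1)) * q = -(w * q ^ 2 * q ^ m) by ring,
    show -(w * q ^ (2 * (m + 1) + 2)) = -(w * q ^ 2 * q ^ (2 * m + 2)) by ring]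
  ring

/-- Both arguments tend to zero and the estimate for `qPoch` is uniform in the length, so the
growing finite product and the infinite one both tend to 1. -/
theorem tendsto_paramDenom {q : ℂ} (hq : ‖q‖ < 1) (w : ℂ) :
    Tendsto (fun n => paramDenom q w n) atTop (𝓝 1) := by
  have hq2 : ‖q ^ 2‖ ≤ ‖q‖ := by
    rw [norm_pow]; exact pow_le_of_le_one (norm_nonneg _) hq.le two_ne_zero
  have hpow := tendsto_pow_atTop_nhds_zero_of_norm_lt_one hq
  have haux : ∀ a : ℕ → ℂ, Tendsto a atTop (𝓝 0) →
      Tendsto (fun n => Real.exp (‖a n‖ * (1 - ‖q‖)⁻¹) - 1) atTop (𝓝 0) := fun a ha => by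
    have h := ((Real.continuous_exp.tendsto _).comp (ha.norm.mul_const (1 - ‖q‖)⁻¹)).sub_const 1
    simpa using h
  have key : ∀ (a : ℕ → ℂ) (f : ℕ → ℂ), Tendsto a atTop (𝓝 0) →
      (∀ n, ‖f n - 1‖ ≤ Real.exp (‖a n‖ * (1 - ‖q‖)⁻¹) - 1) → Tendsto f atTop (𝓝 1) :=
    fun a f ha hf => tendsto_iff_norm_sub_tendsto_zero.2
      (squeeze_zero (fun _ => norm_nonneg _) hf (haux a ha))
  have h1 : Tendsto (fun n => -(w * q ^ n)) atTop (𝓝 0) := by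
    simpa using (hpow.const_mul w).neg
  have h2 : Tendsto (fun n => -(w * q ^ (2 * n + 2))) atTop (𝓝 0) := by
    have : Tendsto (fun n : ℕ => 2 * n + 2) atTop atTop :=
      tendsto_atTop_mono (fun n => by simp only [id_eq]; omega) tendsto_id
    simpa using ((hpow.comp this).const_mul w).neg
  have h3 := key _ (fun n => qPoch (-(w * q ^ n)) q (n + 1)) h1
    fun n => norm_qPoch_sub_one_le hq le_rfl _
  have h4 := key _ (fun n => qPochInf (-(w * q ^ (2 * n + 2))) (q ^ 2)) h2 fun n =>
    le_of_tendsto' (((tendsto_qPoch _ (hq2.trans_lt hq)).sub_const 1).norm)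
      fun m => norm_qPoch_sub_one_le hq hq2 m
  simpa [paramDenom] using h3.mul h4

/-! ### Recurrence for the basic series and passage to Rogers' series -/

namespace IsPochBound

variable {r c : ℝ}

theorem le_norm_paramDenom (H : IsPochBound r c) {q w : ℂ} (hq : ‖q‖ ≤ r) (hw : ‖w‖ ≤ 1) {n : ℕ}
    (hn : n ≠ 0) : c * c ≤ ‖paramDenom q w n‖ := by
  have hq2 := H.norm_pow_le hq two_ne_zero
  have hb : ∀ k, k ≠ 0 → ‖-(w * q ^ k)‖ ≤ r := fun k hk => by
    rw [norm_neg, norm_mul]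
    exact (mul_le_of_le_one_left (norm_nonneg _) hw).trans (H.norm_pow_le hq hk)
  rw [paramDenom, norm_mul]
  refine mul_le_mul (H.le_norm _ _ _ (hb n hn) hq) ?_ H.pos.le (norm_nonneg _)
  exact ge_of_tendsto' (tendsto_qPoch _ (hq2.trans_lt H.lt_one)).norm
    fun m => H.le_norm _ _ _ (hb _ (by omega)) hq2

theorem paramDenom_ne_zero (H : IsPochBound r c) {q w : ℂ} (hq : ‖q‖ ≤ r) (hw : ‖w‖ ≤ 1) {n : ℕ}
    (hn : n ≠ 0) : paramDenom q w n ≠ 0 :=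
  norm_pos_iff.1 ((mul_pos H.pos H.pos).trans_le (H.le_norm_paramDenom hq hw hn))

theorem paramSeries_summable (H : IsPochBound r c) {q w : ℂ} (hq : ‖q‖ ≤ r) (hw : ‖w‖ ≤ 1) :
    Summable (fun n : ℕ => q ^ (n + 1) / paramDenom q w (n + 1)) ∧
      ‖paramSeries q w‖ ≤ (1 - r)⁻¹ * (c * c)⁻¹ :=
  summable_div_of_le H.nonneg H.lt_one (mul_pos H.pos H.pos)
    (fun n => by
      rw [norm_pow]
      exact (pow_le_pow_left₀ (norm_nonneg _) hq _).trans
        (pow_le_pow_of_le_one H.nonneg H.lt_one.le n.le_succ))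
    (fun n => H.le_norm_paramDenom hq hw n.succ_ne_zero)

theorem norm_mul_sq_le_one (H : IsPochBound r c) {q w : ℂ} (hq : ‖q‖ ≤ r) (hw : ‖w‖ ≤ 1) :
    ‖w * q ^ 2‖ ≤ 1 := by
  rw [norm_mul]
  exact mul_le_one₀ hw (norm_nonneg _) ((H.norm_pow_le hq two_ne_zero).trans H.lt_one.le)

/-- The series of `h` is `h 0` plus `q` times the series at `w q²`, while `(1 + wq)` times the
original series differs from it by a telescoping sum of `V`. The boundary term `q * V 0` equals `h
0`, and the limit 1 of `V` leaves the constant `q`. -/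
theorem paramSeries_step (H : IsPochBound r c) {q w : ℂ} (hq : ‖q‖ ≤ r) (hw : ‖w‖ ≤ 1) :
    (1 + w * q) * paramSeries q w = q + q * paramSeries q (w * q ^ 2) := by
  have hq1 := hq.trans_lt H.lt_one
  have hD : ∀ n, paramDenom q w (n + 1) ≠ 0 := fun n => H.paramDenom_ne_zero hq hw n.succ_ne_zero
  have hw2 := H.norm_mul_sq_le_one hq hw
  have hF := (H.paramSeries_summable hq hw).1
  have hF2 := (H.paramSeries_summable hq hw2).1
  have hpow := tendsto_pow_atTop_nhds_zero_of_norm_lt_one hq1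
  -- the telescoping sequence
  set V : ℕ → ℂ := fun n => (1 + w * q ^ (2 * n + 1)) / paramDenom q w (n + 1) with hV
  have hVstep : ∀ n, V (n + 1) = (1 + w * q ^ (n + 1)) / paramDenom q w (n + 1) := fun n => by
    rw [hV]
    simp only
    rw [div_eq_div_iff (hD _) (hD _)]
    linear_combination paramDenom_succ hq1 w (n + 1)
  have hVlim : Tendsto V atTop (𝓝 1) := by
    have h2 : Tendsto (fun n : ℕ => 2 * n + 1) atTop atTop :=
      tendsto_atTop_mono (fun n => by simp only [id_eq]; omega) tendsto_id
    have h := (((hpow.comp h2).const_mul w).const_add 1).div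
      ((tendsto_add_atTop_iff_nat 1).2 (tendsto_paramDenom hq1 w)) one_ne_zero
    rw [mul_zero, add_zero, div_one] at h
    exact h
  -- the shifted series
  set h : ℕ → ℂ := fun n => q ^ (n + 1) * (1 + w * q ^ (n + 1)) / paramDenom q w (n + 1) with hh
  have hhstep : ∀ n, h (n + 1) = q * (q ^ (n + 1) / paramDenom q (w * q ^ 2) (n + 1)) := fun n => by
    have h5 : paramDenom q (w * q ^ 2) (n + 1) ≠ 0 :=
      H.paramDenom_ne_zero hq hw2 n.succ_ne_zero
    have h6 := hD (n + 1)
    rw [paramDenom_succ_eq] at h6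
    have h7 := left_ne_zero_of_mul h6
    rw [hh]
    simp only
    rw [paramDenom_succ_eq, mul_comm (q ^ (n + 1 + 1)),
      mul_div_mul_left _ _ h7, pow_succ' q (n + 1), mul_div_assoc]
  have hhs : Summable h := by
    rw [← summable_nat_add_iff 1]
    simp only [hhstep]
    exact hF2.mul_left q
  have e1 : q * paramSeries q (w * q ^ 2) = ∑' n, h n - h 0 := by
    rw [hhs.tsum_eq_zero_add, paramSeries, ← tsum_mul_left]
    simp only [hhstep]
    ring
  have hterm : ∀ n, (1 + w * q) * (q ^ (n + 1) / paramDenom q w (n + 1)) - h n =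
      -q * (V n - V (n + 1)) := fun n => by
    rw [hVstep, hh, hV]
    have := hD n
    field_simp
    ring
  have hsub := (hF.mul_left (1 + w * q)).sub hhs
  have e2 : (1 + w * q) * paramSeries q w - ∑' n, h n = -q * (V 0 - 1) := by
    rw [paramSeries, ← tsum_mul_left, ← (hF.mul_left _).tsum_sub hhs]
    refine tendsto_nhds_unique hsub.hasSum.tendsto_sum_nat ?_
    simp only [hterm, ← Finset.mul_sum, Finset.sum_range_sub']
    exact (hVlim.const_sub _).const_mul _
  have e3 : h 0 = q * V 0 := by
    rw [hh, hV]
    simp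
    ring
  linear_combination e2 - e1 - e3

theorem paramSeries_eq_fineSeries (H : IsPochBound r c) {q : ℂ} (hq : ‖q‖ ≤ r) :
    paramSeries q 1 = q * fineSeries (q ^ 2) (-q) q := by
  have hq1 := hq.trans_lt H.lt_one
  have hq2 := H.norm_pow_le hq two_ne_zero
  have hw : ∀ k : ℕ, ‖(q ^ 2) ^ k‖ ≤ 1 := fun k => by
    rw [norm_pow]
    exact pow_le_one₀ (norm_nonneg _) (hq2.trans H.lt_one.le)
  have hb : ∀ k : ℕ, ‖-(q * (q ^ 2) ^ k)‖ ≤ r := fun k => by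
    rw [norm_neg, norm_mul]
    exact (mul_le_of_le_one_right (norm_nonneg _) (hw k)).trans hq
  -- Both terms are sampled at `w = q^(2k)`; subtracting their recurrences cancels the constant `q`,
  -- and `k = 0` is the claim.
  have h := eq_zero_of_bounded_recurrence
    (u := fun k => paramSeries q ((q ^ 2) ^ k) - q * fineSeries (q ^ 2) (-(q * (q ^ 2) ^ k)) q)
    (c := fun k => q / (1 + q * (q ^ 2) ^ k)) (l := q / (1 + q * 0))
    (M := (1 - r)⁻¹ * (c * c)⁻¹ + r * ((1 - r)⁻¹ * c⁻¹)) ?_ ?_ ?_ ?_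
  · simpa [sub_eq_zero] using h
  · intro k
    refine (norm_sub_le _ _).trans (add_le_add (H.paramSeries_summable hq (hw k)).2 ?_)
    rw [norm_mul]
    have := (H.fineSeries_summable hq2 (hb k) hq).2
    have := H.nonneg
    gcongr
  · intro k
    have h1 := H.paramSeries_step hq (hw k)
    have h2 := H.fineSeries_eq_left hq2 (hb k) hq
    have h3 := H.one_sub_ne_zero (hb k)
    rw [sub_neg_eq_add] at h2 h3
    simp only [pow_succ (q ^ 2) k]
    rw [show -(q * (q ^ 2) ^ k) * q ^ 2 = -(q * ((q ^ 2) ^ k * q ^ 2)) by ring] at h2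
    rw [div_mul_eq_mul_div, eq_div_iff h3]
    linear_combination h1 - q * h2
  · have := tendsto_pow_atTop_nhds_zero_of_norm_lt_one (hq2.trans_lt H.lt_one)
    exact tendsto_const_nhds.div ((this.const_mul q).const_add 1) (by simp)
  · simpa using hq1

theorem fineSeries_neg_eq_rogersSeries (H : IsPochBound r c) {q x : ℂ} (hq : ‖q‖ ≤ r)
    (hx : ‖x‖ ≤ r) : fineSeries q (-x) x = rogersSeries q (x ^ 2) (x ^ 2) := by
  have hxk : ∀ k : ℕ, ‖x * q ^ k‖ ≤ r := fun k => by
    rw [norm_mul, norm_pow]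
    exact (mul_le_of_le_one_right (norm_nonneg _)
      (pow_le_one₀ (norm_nonneg _) (hq.trans H.lt_one.le))).trans hx
  -- Sampling at `x q^k`: on `b = -t` the product `(1 - t)(1 - b)` becomes `1 - t²`, so
  -- `fineSeries_step` and `rogersSeries_eq_shift` have equal coefficients.
  have h := eq_zero_of_bounded_recurrence
    (u := fun k => fineSeries q (-(x * q ^ k)) (x * q ^ k) -
      rogersSeries q ((x * q ^ k) ^ 2) ((x * q ^ k) ^ 2))
    (c := fun k => -((x * q ^ k) ^ 2 * q) / (1 - (x * q ^ k) ^ 2))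
    (l := -((x * 0) ^ 2 * q) / (1 - (x * 0) ^ 2))
    (M := (1 - r)⁻¹ * c⁻¹ + (1 - r)⁻¹ * c⁻¹) ?_ ?_ ?_ ?_
  · simpa [sub_eq_zero] using h
  · intro k
    have hx2 := H.norm_pow_le (hxk k) two_ne_zero
    refine (norm_sub_le _ _).trans (add_le_add
      (H.fineSeries_summable hq (by rw [norm_neg]; exact hxk k) (hxk k)).2
      (H.rogersSeries_summable hq hx2 hx2).2)
  · intro k
    have hx2 := H.norm_pow_le (hxk k) two_ne_zero
    have h1 := H.fineSeries_step hq (by rw [norm_neg]; exact hxk k) (hxk k)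
    have h2 := H.rogersSeries_eq_shift hq hx2 hx2
    have h3 := H.one_sub_ne_zero hx2
    simp only [pow_succ q k]
    rw [show -(x * q ^ k) * q = -(x * (q ^ k * q)) by ring,
      show x * q ^ k * q = x * (q ^ k * q) by ring] at h1
    rw [show (x * q ^ k) ^ 2 * q ^ 2 = (x * (q ^ k * q)) ^ 2 by ring] at h2
    rw [div_mul_eq_mul_div, eq_div_iff h3]
    linear_combination h1 - h2
  · have := tendsto_pow_atTop_nhds_zero_of_norm_lt_one (hq.trans_lt H.lt_one)
    exact ((((this.const_mul x).pow 2).mul_const q).neg).div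
      (((this.const_mul x).pow 2).const_sub 1) (by simp)
  · simp

end IsPochBound

/-! ### Rogers' false theta series -/

/-- The tail `∑ (-1)^i q^(3i²+6ij+2i) (1 + q^(2i+2j+1))` of Rogers' false theta series. -/
noncomputable def falseTheta (q : ℂ) (j : ℕ) : ℂ :=
  ∑' i : ℕ, (-1) ^ i * q ^ (3 * i ^ 2 + 6 * i * j + 2 * i) * (1 + q ^ (2 * i + 2 * j + 1))

theorem falseTheta_summable {q : ℂ} (hq : ‖q‖ < 1) (j : ℕ) :
    Summable (fun i : ℕ => (-1) ^ i * q ^ (3 * i ^ 2 + 6 * i * j + 2 * i) *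
      (1 + q ^ (2 * i + 2 * j + 1))) ∧ ‖falseTheta q j‖ ≤ (1 - ‖q‖)⁻¹ * 2 := by
  have hg := (hasSum_geometric_of_lt_one (norm_nonneg q) hq).mul_right 2
  have hb : ∀ i : ℕ, ‖(-1) ^ i * q ^ (3 * i ^ 2 + 6 * i * j + 2 * i) *
      (1 + q ^ (2 * i + 2 * j + 1))‖ ≤ ‖q‖ ^ i * 2 := fun i => by
    rw [norm_mul, norm_mul, norm_pow, norm_neg, norm_one, one_pow, one_mul, norm_pow]
    refine mul_le_mul (pow_le_pow_of_le_one (norm_nonneg _) hq.le ?_) ?_ (norm_nonneg _)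
      (by positivity)
    · nlinarith [Nat.zero_le (3 * i ^ 2 + 6 * i * j)]
    · refine (norm_add_le _ _).trans ?_
      rw [norm_one, norm_pow]
      have := pow_le_one₀ (norm_nonneg q) hq.le (n := 2 * i + 2 * j + 1)
      linarith
  exact ⟨Summable.of_norm_bounded hg.summable hb, tsum_of_norm_bounded hg hb⟩

theorem falseTheta_step {q : ℂ} (hq : ‖q‖ < 1) (j : ℕ) :
    falseTheta q j = 1 + q ^ (2 * j + 1) - q ^ (6 * j + 5) * falseTheta q (j + 1) := by
  unfold falseTheta
  rw [(falseTheta_summable hq j).1.tsum_eq_zero_add,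
    sub_eq_add_neg (1 + q ^ (2 * j + 1)), ← neg_mul, ← tsum_mul_left]
  congr 1
  · simp
  · exact tsum_congr fun i => by ring

theorem IsPochBound.rogersSeries_eq_falseTheta {r c : ℝ} (H : IsPochBound r c) {q : ℂ}
    (hq : ‖q‖ ≤ r) : rogersSeries q q q = falseTheta q 0 := by
  have hq1 := hq.trans_lt H.lt_one
  have h := eq_zero_of_bounded_recurrence
    (u := fun j => rogersSeries q (q ^ (4 * j + 1)) (q ^ (2 * j + 1)) - falseTheta q j)
    (c := fun j => -q ^ (6 * j + 5)) (l := -0)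
    (M := (1 - r)⁻¹ * c⁻¹ + (1 - ‖q‖)⁻¹ * 2) ?_ ?_ ?_ ?_
  · simpa [sub_eq_zero] using h
  · intro j
    exact (norm_sub_le _ _).trans (add_le_add
      (H.rogersSeries_summable hq (H.norm_pow_le hq (by omega)) (H.norm_pow_le hq (by omega))).2
      (falseTheta_summable hq1 j).2)
  · intro j
    have hy : ‖q ^ (2 * j + 1)‖ ≤ r := H.norm_pow_le hq (by omega)
    have h1 := H.rogersSeries_step hq (H.norm_pow_le hq (show 4 * j + 1 ≠ 0 by omega)) hy
    have h2 := falseTheta_step hq1 j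
    have h3 := H.one_sub_ne_zero hy
    rw [show q ^ (4 * j + 1) * q ^ 4 = q ^ (4 * (j + 1) + 1) by ring,
      show q ^ (2 * j + 1) * q ^ 2 = q ^ (2 * (j + 1) + 1) by ring] at h1
    -- With `y = q^(2j+1)` and `d q = y²`, both `1 - d q` and `y - d q` contain the factor `1 - y`;
    -- cancelling it leaves the recurrence of `falseTheta`.
    refine mul_left_cancel₀ h3 ?_
    linear_combination h1 - (1 - q ^ (2 * j + 1)) * h2
  · have h2 : Tendsto (fun j : ℕ => 6 * j + 5) atTop atTop :=
      tendsto_atTop_mono (fun n => by simp only [id_eq]; omega) tendsto_id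
    exact ((tendsto_pow_atTop_nhds_zero_of_norm_lt_one hq1).comp h2).neg
  · simp

theorem hasSum_falseTheta {q : ℂ} (hq : ‖q‖ < 1) :
    HasSum (fun j : ℕ => (-1 : ℂ) ^ j * q ^ (6 * j ^ 2 + 4 * j + 1) * (1 + q ^ (4 * j + 2)))
      (q * falseTheta (q ^ 2) 0) := by
  have hq2 : ‖q ^ 2‖ < 1 := by
    rw [norm_pow]; exact pow_lt_one₀ (norm_nonneg _) hq two_ne_zero
  have h : HasSum _ (q * falseTheta (q ^ 2) 0) :=
    (falseTheta_summable hq2 0).1.hasSum.mul_left q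
  convert h using 1
  funext j
  ring

/-- The evaluations are chained in base `q²` with `x = q`, so that `x²` is the base itself. -/
theorem IsPochBound.hasSum_pentDenom {r c : ℝ} (H : IsPochBound r c) {q : ℂ} (hq : ‖q‖ ≤ r) :
    HasSum (fun n : ℕ => q ^ (n + 1) / pentDenom q (n + 1)) (q * falseTheta (q ^ 2) 0) := by
  have hq2 := H.norm_pow_le hq two_ne_zero
  rw [← H.rogersSeries_eq_falseTheta hq2, ← H.fineSeries_neg_eq_rogersSeries hq2 hq,
    ← H.paramSeries_eq_fineSeries hq]
  simpa only [paramDenom_one, paramSeries] using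
    (H.paramSeries_summable hq (w := 1) (by simp)).1.hasSum

theorem exists_isPochBound {q : ℂ} (hq : ‖q‖ < 1) : ∃ c, IsPochBound ‖q‖ c := by
  obtain ⟨c, hc, h⟩ := exists_le_norm_qPoch (norm_nonneg q) hq
  exact ⟨c, norm_nonneg q, hq, hc, h⟩

/-! ### Signed partition counts -/

open Classical in
/-- The number of partitions of `n` with all parts in `S`, each counted with sign `(-1)^length`. -/
noncomputable def signedCount (S : Set ℕ) (n : ℕ) : ℤ :=
  ∑ p : n.Partition with ∀ i ∈ p.parts, i ∈ S, (-1) ^ Multiset.card p.parts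

open Classical in
/-- The signed number of partitions of `n` with all parts in `S` and with `k` among the parts. -/
noncomputable def signedCountMem (S : Set ℕ) (k n : ℕ) : ℤ :=
  ∑ p : n.Partition with (∀ i ∈ p.parts, i ∈ S) ∧ k ∈ p.parts, (-1) ^ Multiset.card p.parts

/-- Removing one copy of `k`. -/
theorem signedCountMem_add {S : Set ℕ} {k : ℕ} (hk : k ∈ S) (hk0 : 0 < k) (n : ℕ) :
    signedCountMem S k (n + k) = -signedCount S n := by
  classical
  rw [signedCountMem, signedCount, ← Finset.sum_neg_distrib]
  symm
  refine Finset.sum_bij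
    (fun p _ => (⟨k ::ₘ p.parts, ?_, ?_⟩ : (n + k).Partition)) ?_ ?_ ?_ ?_
  · intro i hi
    rcases Multiset.mem_cons.1 hi with rfl | hi
    exacts [hk0, p.parts_pos hi]
  · rw [Multiset.sum_cons, p.parts_sum, add_comm]
  · intro p hp
    have hp' := (Finset.mem_filter.1 hp).2
    simp only [Finset.mem_filter, Finset.mem_univ, true_and, Multiset.mem_cons, true_or, and_true]
    rintro i (rfl | hi)
    exacts [hk, hp' i hi]
  · intro p _ p' _ h
    have := congrArg Nat.Partition.parts h
    exact Nat.Partition.ext ((Multiset.cons_inj_right k).1 this)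
  · intro p hp
    obtain ⟨hS, hkp⟩ := (Finset.mem_filter.1 hp).2
    refine ⟨⟨p.parts.erase k, fun hi => p.parts_pos (Multiset.mem_of_mem_erase hi), ?_⟩, ?_, ?_⟩
    · have := Multiset.sum_cons k (p.parts.erase k)
      rw [Multiset.cons_erase hkp, p.parts_sum] at this
      omega
    · simp only [Finset.mem_filter, Finset.mem_univ, true_and]
      exact fun i hi => hS i (Multiset.mem_of_mem_erase hi)
    · exact Nat.Partition.ext (Multiset.cons_erase hkp)
  · intro p _
    simp [pow_succ]

theorem signedCountMem_eq_zero {S : Set ℕ} {k n : ℕ} (h : n < k) : signedCountMem S k n = 0 := by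
  classical
  rw [signedCountMem, Finset.filter_false_of_mem, Finset.sum_empty]
  rintro p - ⟨-, hk⟩
  have := Multiset.le_sum_of_mem hk
  rw [p.parts_sum] at this
  omega

/-- Partitions are images of compositions, of which there are `2^(n-1)` for `n ≥ 1`; this crude
bound is the source of the radius 1/2. -/
theorem abs_signedCount_le (S : Set ℕ) (n : ℕ) : |signedCount S n| ≤ 2 ^ n := by
  classical
  calc |signedCount S n| ≤ ∑ p : n.Partition with ∀ i ∈ p.parts, i ∈ S, (1 : ℤ) := by
        refine (Finset.abs_sum_le_sum_abs _ _).trans_eq (Finset.sum_congr rfl fun p _ => ?_)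
        simp
    _ ≤ (Fintype.card n.Partition : ℤ) := by
        rw [Finset.sum_const, nsmul_eq_mul, mul_one]
        exact_mod_cast Finset.card_le_univ _
    _ ≤ 2 ^ n := by
        have h := Fintype.card_le_of_surjective _ (Nat.Partition.ofComposition_surj (n := n))
        rw [composition_card] at h
        exact_mod_cast h.trans (Nat.pow_le_pow_right two_pos (Nat.sub_le n 1))

theorem signedCount_congr {S T : Set ℕ} {n : ℕ} (h : ∀ i ≤ n, 0 < i → (i ∈ S ↔ i ∈ T)) :
    signedCount S n = signedCount T n := by
  classical
  unfold signedCount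
  congr 1
  refine Finset.filter_congr fun p _ => forall₂_congr fun i hi => h i ?_ (p.parts_pos hi)
  have := Multiset.le_sum_of_mem hi
  rwa [p.parts_sum] at this

theorem signedCount_insert {S : Set ℕ} {k : ℕ} (hk : k ∉ S) (n : ℕ) :
    signedCount (insert k S) n = signedCount S n + signedCountMem (insert k S) k n := by
  classical
  unfold signedCount signedCountMem
  rw [← Finset.sum_filter_add_sum_filter_not _ (fun p : n.Partition => k ∈ p.parts),
    Finset.filter_filter, Finset.filter_filter, add_comm]
  refine congrArg₂ _ (Finset.sum_congr ?_ fun _ _ => rfl)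
    (Finset.sum_congr (by congr) fun _ _ => rfl)
  ext p
  simp only [Finset.mem_filter, Finset.mem_univ, true_and, Set.mem_insert_iff]
  constructor
  · rintro ⟨h1, h2⟩ i hi
    exact (h1 i hi).resolve_left fun h => h2 (h ▸ hi)
  · exact fun h => ⟨fun i hi => Or.inr (h i hi), fun h2 => hk (h k h2)⟩

theorem signedCount_of_forall_notMem {S : Set ℕ} (hS : ∀ i, i ∉ S) (n : ℕ) :
    signedCount S n = if n = 0 then 1 else 0 := by
  classical
  unfold signedCount
  split_ifs with h
  · subst h
    rw [Finset.filter_true_of_mem]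
    · simp [Subsingleton.elim (default : Nat.Partition 0) (Nat.Partition.indiscrete 0)]
    · intro p _ i hi
      have := Multiset.le_sum_of_mem hi
      rw [p.parts_sum] at this
      have := p.parts_pos hi
      omega
  · rw [Finset.filter_false_of_mem, Finset.sum_empty]
    intro p _ hp
    have h0 : p.parts = 0 := Multiset.eq_zero_of_forall_notMem fun i hi => hS i (hp i hi)
    have := p.parts_sum
    rw [h0, Multiset.sum_zero] at this
    exact h this.symm

theorem norm_signedCount_mul_le (S : Set ℕ) (q : ℂ) (n : ℕ) :
    ‖(signedCount S n : ℂ) * q ^ n‖ ≤ (2 * ‖q‖) ^ n := by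
  rw [norm_mul, norm_pow, mul_pow, Complex.norm_intCast]
  gcongr
  exact_mod_cast abs_signedCount_le S n

theorem summable_signedCount (S : Set ℕ) {q : ℂ} (hq : ‖q‖ < 1 / 2) :
    Summable fun n : ℕ => (signedCount S n : ℂ) * q ^ n :=
  Summable.of_norm_bounded
    (summable_geometric_of_lt_one (r := 2 * ‖q‖) (by positivity) (by linarith))
    (norm_signedCount_mul_le S q)

/-- Generating function of the signed partition counts with parts in a finite set. -/
theorem tsum_signedCount_mul_prod {q : ℂ} (hq : ‖q‖ < 1 / 2) (S : Finset ℕ) (hS : ∀ k ∈ S, 0 < k) :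
    (∑' n : ℕ, (signedCount S n : ℂ) * q ^ n) * ∏ k ∈ S, (1 + q ^ k) = 1 := by
  classical
  induction S using Finset.induction_on with
  | empty =>
    rw [Finset.prod_empty, mul_one, tsum_eq_single 0]
    · simp [signedCount_of_forall_notMem]
    · intro n hn
      simp [signedCount_of_forall_notMem, hn]
  | insert k S hk ih =>
    rw [Finset.prod_insert hk, ← mul_assoc]
    refine Eq.trans ?_ (ih fun i hi => hS i (Finset.mem_insert_of_mem hi))
    congr 1
    have hk0 := hS k (Finset.mem_insert_self _ _)
    have hsI := summable_signedCount (insert k (S : Set ℕ)) hq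
    have hs := summable_signedCount (S : Set ℕ) hq
    rw [Finset.coe_insert]
    -- `e` counts the partitions that do contain `k`: it vanishes below `k`, and removing one `k`
    -- turns the rest into `-q^k` times the series for `insert k S`.
    set e : ℕ → ℂ := fun n =>
      (signedCount (insert k (S : Set ℕ)) n : ℂ) * q ^ n - (signedCount (S : Set ℕ) n : ℂ) * q ^ n
      with he
    have hes : Summable e := hsI.sub hs
    have h0 : ∑ i ∈ Finset.range k, e i = 0 := by
      refine Finset.sum_eq_zero fun n hn => ?_
      rw [he]
      simp only
      rw [signedCount_insert (by simpa using hk),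
        signedCountMem_eq_zero (Finset.mem_range.1 hn), add_zero, sub_self]
    have h1 : ∀ n, e (n + k) = -q ^ k * ((signedCount (insert k (S : Set ℕ)) n : ℂ) * q ^ n) := by
      intro n
      rw [he]
      simp only
      rw [signedCount_insert (by simpa using hk),
        signedCountMem_add (Set.mem_insert _ _) hk0 n]
      push_cast
      ring
    have h2 := hes.sum_add_tsum_nat_add k
    simp only [h0, h1, zero_add, tsum_mul_left] at h2
    rw [hsI.tsum_sub hs] at h2
    linear_combination -h2

/-! ### Generating function of the partitions with restricted odd parts -/

/-- The part sizes allowed when the smallest part is `m`. -/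
def admissibleParts (m : ℕ) : Set ℕ := {k | m ≤ k ∧ (Odd k → k < 2 * m)}

/-- A finite section of `admissibleParts m`. -/
def admissibleFinset (m J : ℕ) : Finset ℕ :=
  Finset.Icc m (2 * m) ∪ (Finset.range J).image fun i => 2 * m + 2 + 2 * i

theorem mem_admissibleFinset_iff {m J k : ℕ} (hk : k ≤ J) :
    k ∈ admissibleFinset m J ↔ k ∈ admissibleParts m := by
  simp only [admissibleFinset, admissibleParts, Finset.mem_union, Finset.mem_Icc, Finset.mem_image,
    Finset.mem_range, Set.mem_ofPred_eq]
  constructor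
  · rintro (⟨h1, h2⟩ | ⟨i, -, rfl⟩)
    · refine ⟨h1, fun ⟨a, ha⟩ => by omega⟩
    · exact ⟨by omega, fun ⟨a, ha⟩ => by omega⟩
  · rintro ⟨h1, h2⟩
    by_cases h : k ≤ 2 * m
    · exact Or.inl ⟨h1, h⟩
    · rcases Nat.even_or_odd k with ⟨a, ha⟩ | ho
      · exact Or.inr ⟨a - m - 1, by omega, by omega⟩
      · have := h2 ho
        omega

theorem prod_admissibleFinset (q : ℂ) (m J : ℕ) :
    ∏ k ∈ admissibleFinset m J, (1 + q ^ k) =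
      qPoch (-q ^ m) q (m + 1) * qPoch (-q ^ (2 * m + 2)) (q ^ 2) J := by
  rw [admissibleFinset, Finset.prod_union, Finset.prod_image (fun i _ j _ h => by
    simpa using h)]
  · congr 1
    · rw [qPoch, ← Finset.Ico_succ_right_eq_Icc, Finset.prod_Ico_eq_prod_range]
      simp only [Nat.succ_eq_succ, Nat.succ_eq_add_one]
      rw [show 2 * m + 1 - m = m + 1 by omega]
      exact Finset.prod_congr rfl fun i _ => by ring
    · exact Finset.prod_congr rfl fun i _ => by ring
  · rw [Finset.disjoint_left]
    intro a ha hb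
    obtain ⟨i, -, rfl⟩ := Finset.mem_image.1 hb
    have := (Finset.mem_Icc.1 ha).2
    omega

/-- For fixed `n` the coefficient for `admissibleFinset m J` is constant once `J ≥ n`, and all are
dominated by `(2‖q‖)^n`, so the finite product formula passes to the limit. -/
theorem tsum_signedCount_mul_pentDenom {q : ℂ} (hq : ‖q‖ < 1 / 2) {m : ℕ} (hm : 0 < m) :
    (∑' n : ℕ, (signedCount (admissibleParts m) n : ℂ) * q ^ n) * pentDenom q m = 1 := by
  have hq2 : ‖q ^ 2‖ < 1 := by
    rw [norm_pow]; exact pow_lt_one₀ (norm_nonneg _) (by linarith) two_ne_zero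
  have h1 : Tendsto (fun J : ℕ => ∑' n : ℕ, (signedCount (admissibleFinset m J) n : ℂ) * q ^ n)
      atTop (𝓝 (∑' n : ℕ, (signedCount (admissibleParts m) n : ℂ) * q ^ n)) := by
    refine tendsto_tsum_of_dominated_convergence
      (summable_geometric_of_lt_one (r := 2 * ‖q‖) (by positivity) (by linarith)) (fun n => ?_)
      (Eventually.of_forall fun J n => norm_signedCount_mul_le _ q n)
    refine tendsto_const_nhds.congr' ?_
    filter_upwards [eventually_ge_atTop n] with J hJ
    rw [signedCount_congr fun i hi _ => ?_]
    rw [Finset.mem_coe, mem_admissibleFinset_iff (hi.trans hJ)]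
  have h2 : Tendsto (fun J : ℕ => ∏ k ∈ admissibleFinset m J, (1 + q ^ k)) atTop
      (𝓝 (pentDenom q m)) := by
    simp only [prod_admissibleFinset]
    exact (tendsto_qPoch _ hq2).const_mul _
  refine tendsto_nhds_unique (h1.mul h2) ?_
  refine tendsto_const_nhds.congr fun J => (tsum_signedCount_mul_prod hq _ fun k hk => ?_).symm
  rcases Finset.mem_union.1 hk with h | h
  · exact hm.trans_le (Finset.mem_Icc.1 h).1
  · obtain ⟨i, -, rfl⟩ := Finset.mem_image.1 h
    omega

theorem smallestPart_mem {n : ℕ} (hn : 0 < n) (p : n.Partition) : smallestPart p ∈ p.parts := by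
  have h : {i : ℕ | i ∈ p.parts}.Nonempty := by
    rw [Set.nonempty_iff_ne_empty]
    intro h
    have h0 : p.parts = 0 := Multiset.eq_zero_of_forall_notMem fun i hi => by
      have : i ∈ {i : ℕ | i ∈ p.parts} := hi
      simp [h] at this
    have := p.parts_sum
    rw [h0, Multiset.sum_zero] at this
    omega
  exact Nat.sInf_mem h

theorem smallestPart_le {n : ℕ} {p : n.Partition} {i : ℕ} (hi : i ∈ p.parts) :
    smallestPart p ≤ i :=
  Nat.sInf_le hi

theorem oddPartsLtTwiceSmallest_and_smallestPart_eq_iff {n : ℕ} (hn : 0 < n) (p : n.Partition)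
    (m : ℕ) : OddPartsLtTwiceSmallest p ∧ smallestPart p = m ↔
      (∀ i ∈ p.parts, i ∈ admissibleParts m) ∧ m ∈ p.parts := by
  constructor
  · rintro ⟨h, rfl⟩
    exact ⟨fun i hi => ⟨smallestPart_le hi, h i hi⟩, smallestPart_mem hn p⟩
  · rintro ⟨h, hm⟩
    have hs : smallestPart p = m :=
      le_antisymm (smallestPart_le hm) (h _ (smallestPart_mem hn p)).1
    exact ⟨fun i hi ho => hs ▸ (h i hi).2 ho, hs⟩

open Classical in
theorem dOdd_sub_dEven_eq_neg_sum (n : ℕ) : (dOdd n : ℤ) - dEven n =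
    -∑ p : n.Partition with OddPartsLtTwiceSmallest p, (-1) ^ Multiset.card p.parts := by
  have h1 : dOdd n = (Finset.univ.filter fun p : n.Partition =>
      OddPartsLtTwiceSmallest p ∧ Odd (Multiset.card p.parts)).card := by
    rw [dOdd]; congr 1; ext p; simp
  have h2 : dEven n = (Finset.univ.filter fun p : n.Partition =>
      OddPartsLtTwiceSmallest p ∧ ¬ Odd (Multiset.card p.parts)).card := by
    rw [dEven]; congr 1; ext p; simp
  rw [h1, h2, ← Finset.sum_filter_add_sum_filter_not _
      (fun p : n.Partition => Odd (Multiset.card p.parts)),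
    Finset.filter_filter, Finset.filter_filter,
    Finset.sum_congr rfl fun p hp => (Finset.mem_filter.1 hp).2.2.neg_one_pow,
    Finset.sum_congr rfl fun p hp =>
      (Nat.not_odd_iff_even.1 (Finset.mem_filter.1 hp).2.2).neg_one_pow]
  simp
  ring

theorem dOdd_sub_dEven_eq_sum (n : ℕ) : (dOdd (n + 1) : ℤ) - dEven (n + 1) =
    ∑ x ∈ Finset.HasAntidiagonal.antidiagonal n, signedCount (admissibleParts (x.1 + 1)) x.2 := by
  classical
  rw [dOdd_sub_dEven_eq_neg_sum, Finset.Nat.sum_antidiagonal_eq_sum_range_succ_mk,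
    -- The fibre over `m` consists of the partitions with smallest part `m + 1`; removing one copy
    -- of it leaves a partition of `n - m` and absorbs the minus sign.
    ← Finset.sum_fiberwise_of_maps_to (s := Finset.univ.filter _) (t := Finset.range (n + 1))
      (g := fun p : (n + 1).Partition => smallestPart p - 1), ← Finset.sum_neg_distrib]
  · refine Finset.sum_congr rfl fun m hm => ?_
    have hmn := Finset.mem_range.1 hm
    have h := signedCountMem_add (S := admissibleParts (m + 1)) (k := m + 1)
      ⟨le_rfl, fun _ => by omega⟩ m.succ_pos (n - m)
    rw [show n - m + (m + 1) = n + 1 by omega] at h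
    rw [← neg_eq_iff_eq_neg.2 h, signedCountMem, Finset.filter_filter]
    congr 1
    refine Finset.sum_congr (Finset.filter_congr fun p _ => ?_) fun _ _ => rfl
    rw [← oddPartsLtTwiceSmallest_and_smallestPart_eq_iff n.succ_pos]
    have := p.parts_pos (smallestPart_mem n.succ_pos p)
    refine and_congr_right fun _ => ?_
    omega
  · intro p _
    have hp := smallestPart_mem n.succ_pos p
    have h1 := p.parts_pos hp
    have h2 := Multiset.le_sum_of_mem hp
    rw [p.parts_sum] at h2
    exact Finset.mem_range.2 (by omega)

/-- An absolutely convergent double series is summed in two ways: along the smallest part it gives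
the `pentDenom` series, along antidiagonals the partition differences. -/
theorem hasSum_dOdd_sub_dEven {q : ℂ} (hq : ‖q‖ < 1 / 2) :
    HasSum (fun n : ℕ => (((dOdd (n + 1) : ℤ) - dEven (n + 1) : ℤ) : ℂ) * q ^ (n + 1))
      (q * falseTheta (q ^ 2) 0) := by
  have hq1 : ‖q‖ < 1 := by linarith
  obtain ⟨c, H⟩ := exists_isPochBound hq1
  set f : ℕ × ℕ → ℂ := fun x =>
    q ^ (x.1 + 1) * ((signedCount (admissibleParts (x.1 + 1)) x.2 : ℂ) * q ^ x.2) with hf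
  have hfs : Summable f := by
    have h1 := summable_geometric_of_lt_one (norm_nonneg q) hq1
    have h2 := summable_geometric_of_lt_one (r := 2 * ‖q‖) (by positivity) (by linarith)
    refine Summable.of_norm_bounded
      (h1.mul_of_nonneg h2 (fun _ => by positivity) (fun _ => by positivity)) fun x => ?_
    rw [hf, norm_mul, norm_pow]
    exact mul_le_mul (pow_le_pow_of_le_one (norm_nonneg _) hq1.le (Nat.le_succ _))
      (norm_signedCount_mul_le _ _ _) (norm_nonneg _) (by positivity)
  have hfib : HasSum (fun m : ℕ => q ^ (m + 1) / pentDenom q (m + 1)) (∑' x, f x) := by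
    refine hfs.hasSum.prod_fiberwise fun m => ?_
    have h := tsum_signedCount_mul_pentDenom hq (m := m + 1) (Nat.succ_pos m)
    have h2 := (summable_signedCount (admissibleParts (m + 1)) hq).hasSum.mul_left (q ^ (m + 1))
    rwa [eq_inv_of_mul_eq_one_left h, ← div_eq_mul_inv] at h2
  have htot : HasSum f (q * falseTheta (q ^ 2) 0) := by
    have h := (H.hasSum_pentDenom le_rfl).unique hfib
    rw [h]
    exact hfs.hasSum
  have hsig :=
    ((Finset.HasAntidiagonal.sigmaAntidiagonalEquivProd (A := ℕ)).hasSum_iff.2 htot).sigma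
      fun n => hasSum_fintype _
  convert hsig using 1
  funext n
  rw [dOdd_sub_dEven_eq_sum, Finset.univ_eq_attach, Int.cast_sum, Finset.sum_mul,
    ← Finset.sum_attach]
  refine Finset.sum_congr rfl fun x _ => ?_
  have hx := Finset.HasAntidiagonal.mem_antidiagonal.1 x.2
  simp only [Function.comp_apply, Finset.HasAntidiagonal.sigmaAntidiagonalEquivProd_apply, hf]
  have hxq : q ^ (n + 1) = q ^ (x.1.1 + 1) * q ^ x.1.2 := by
    rw [← pow_add]
    congr 1
    omega
  rw [hxq]
  ring

/-! ### Comparison of coefficients -/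

/-- The exponents occurring in the false theta series. -/
def thetaExponent : ℕ ⊕ ℕ → ℕ :=
  Sum.elim (fun j => 6 * j ^ 2 + 4 * j + 1) fun j => 6 * j ^ 2 + 8 * j + 3

/-- The signs occurring in the false theta series. -/
def thetaSign : ℕ ⊕ ℕ → ℤ := Sum.elim (fun j => (-1) ^ j) fun j => (-1) ^ j

/-- The two families interlace: `6j²+4j+1 < 6j²+8j+3 < 6(j+1)²+4(j+1)+1`. -/
theorem thetaExponent_injective : Function.Injective thetaExponent := by
  rintro (i | i) (j | j) h <;> simp only [thetaExponent, Sum.elim_inl, Sum.elim_inr] at h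
  · rcases lt_trichotomy i j with h' | rfl | h'
    · nlinarith
    · rfl
    · nlinarith
  · rcases le_or_gt i j with h' | h' <;> nlinarith
  · rcases le_or_gt j i with h' | h' <;> nlinarith
  · rcases lt_trichotomy i j with h' | rfl | h'
    · nlinarith
    · rfl
    · nlinarith

theorem hasSum_extend_thetaSign {q : ℂ} (hq : ‖q‖ < 1) :
    HasSum (fun n : ℕ => ((Function.extend thetaExponent thetaSign 0 n : ℤ) : ℂ) * q ^ n)
      (q * falseTheta (q ^ 2) 0) := by
  have hs : ∀ e : ℕ → ℕ, (∀ j, j ≤ e j) → Summable fun j : ℕ => (-1 : ℂ) ^ j * q ^ e j :=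
    fun e he => by
      refine Summable.of_norm_bounded (summable_geometric_of_lt_one (norm_nonneg q) hq) fun j => ?_
      rw [norm_mul, norm_pow, norm_neg, norm_one, one_pow, one_mul, norm_pow]
      exact pow_le_pow_of_le_one (norm_nonneg _) hq.le (he j)
  have h1 := (hs (fun j => 6 * j ^ 2 + 4 * j + 1) fun j => by
    have := Nat.zero_le (6 * j ^ 2); omega).hasSum
  have h2 := (hs (fun j => 6 * j ^ 2 + 8 * j + 3) fun j => by
    have := Nat.zero_le (6 * j ^ 2); omega).hasSum
  have h12 : HasSum (fun x => (thetaSign x : ℂ) * q ^ thetaExponent x) _ := HasSum.sum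
    (by simpa [thetaSign, thetaExponent, Function.comp_def] using h1)
    (by simpa [thetaSign, thetaExponent, Function.comp_def] using h2)
  have heq := (h1.add h2).unique (by
    convert hasSum_falseTheta hq using 1
    funext j
    ring)
  rw [heq, ← hasSum_extend_zero thetaExponent_injective] at h12
  convert h12 using 1
  funext n
  by_cases hn : ∃ x, thetaExponent x = n
  · obtain ⟨x, rfl⟩ := hn
    rw [thetaExponent_injective.extend_apply, thetaExponent_injective.extend_apply]
  · rw [Function.extend_apply' _ _ _ hn, Function.extend_apply' _ _ _ hn]
    simp

theorem eq_of_hasSum_mul_pow {a b : ℕ → ℂ} {f : ℂ → ℂ} {r : ℝ} (hr : 0 < r)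
    (ha : ∀ q : ℂ, ‖q‖ < r → HasSum (fun n => a n * q ^ n) (f q))
    (hb : ∀ q : ℂ, ‖q‖ < r → HasSum (fun n => b n * q ^ n) (f q)) : a = b := by
  have key : ∀ a : ℕ → ℂ, (∀ q : ℂ, ‖q‖ < r → HasSum (fun n => a n * q ^ n) (f q)) →
      HasFPowerSeriesAt f (FormalMultilinearSeries.ofScalars ℂ a) 0 := fun a ha => by
    rw [hasFPowerSeriesAt_iff]
    filter_upwards [Metric.ball_mem_nhds (0 : ℂ) hr] with q hq
    rw [mem_ball_zero_iff] at hq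
    simpa [FormalMultilinearSeries.coeff_ofScalars, mul_comm] using ha q hq
  have h := (key a ha).eq_formalMultilinearSeries (key b hb)
  funext n
  simpa [FormalMultilinearSeries.coeff_ofScalars] using congrArg (fun p => p.coeff n) h

theorem dOdd_sub_dEven_eq_extend (n : ℕ) : (dOdd (n + 1) : ℤ) - dEven (n + 1) =
    Function.extend thetaExponent thetaSign 0 (n + 1) := by
  have h := eq_of_hasSum_mul_pow (r := 1 / 2)
    -- The value at 0 is overridden because the empty partition gives the difference -1 there,
    -- whereas the theta series has no constant term.
    (a := fun n => if n = 0 then 0 else (((dOdd n : ℤ) - dEven n : ℤ) : ℂ))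
    (b := fun n => ((Function.extend thetaExponent thetaSign 0 n : ℤ) : ℂ))
    (f := fun q => q * falseTheta (q ^ 2) 0) (by norm_num) (fun q hq => ?_)
    (fun q hq => hasSum_extend_thetaSign (by linarith))
  · have := congrFun h (n + 1)
    simp only [Nat.succ_ne_zero, if_false] at this
    exact_mod_cast this
  · rw [← hasSum_nat_add_iff' 1]
    simpa using hasSum_dOdd_sub_dEven hq

/-! ### The theorem -/

theorem theorem5p2 :
    -- the identity, for complex `q` with `|q| < 1`, everything in it being meaningful
    (∀ q : ℂ, ‖q‖ < 1 →
      (∀ n : ℕ, 1 ≤ n →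
        Filter.Tendsto (fun m : ℕ => qPoch (-q ^ (2 * n + 2)) (q ^ 2) m) Filter.atTop
          (nhds (qPochInf (-q ^ (2 * n + 2)) (q ^ 2)))) ∧
      (∀ n : ℕ, 1 ≤ n → pentDenom q n ≠ 0) ∧
      Summable (fun n : ℕ+ => q ^ (n : ℕ) / pentDenom q n) ∧
      Summable (fun j : ℕ => (-1 : ℂ) ^ j * q ^ (6 * j ^ 2 + 4 * j + 1) * (1 + q ^ (4 * j + 2))) ∧
      ∑' n : ℕ+, q ^ (n : ℕ) / pentDenom q n =
        ∑' j : ℕ, (-1 : ℂ) ^ j * q ^ (6 * j ^ 2 + 4 * j + 1) * (1 + q ^ (4 * j + 2))) ∧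
    -- its partition-theoretic form
    (∀ n : ℕ, 1 ≤ n →
      (∀ j : ℕ, n = 6 * j ^ 2 + 4 * j + 1 ∨ n = 6 * j ^ 2 + 8 * j + 3 →
        (dOdd n : ℤ) - (dEven n : ℤ) = (-1) ^ j) ∧
      ((¬ ∃ j : ℕ, n = 6 * j ^ 2 + 4 * j + 1 ∨ n = 6 * j ^ 2 + 8 * j + 3) →
        (dOdd n : ℤ) - (dEven n : ℤ) = 0)) := by
  refine ⟨fun q hq => ?_, fun n hn => ?_⟩
  · obtain ⟨c, H⟩ := exists_isPochBound hq
    have hq2 := (H.norm_pow_le le_rfl two_ne_zero).trans_lt hq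
    have hL := H.hasSum_pentDenom le_rfl
    have hR := hasSum_falseTheta hq
    refine ⟨fun n _ => tendsto_qPoch _ hq2, fun n hn => ?_, ?_, hR.summable, ?_⟩
    · rw [← paramDenom_one]
      exact H.paramDenom_ne_zero le_rfl (by simp) (by omega)
    · exact (summable_pnat_iff_summable_succ (f := fun n : ℕ => q ^ n / pentDenom q n)).2
        hL.summable
    · rw [tsum_pnat_eq_tsum_succ (f := fun n : ℕ => q ^ n / pentDenom q n), hL.tsum_eq, hR.tsum_eq]
  · obtain ⟨n, rfl⟩ := Nat.exists_eq_add_of_le' hn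
    rw [dOdd_sub_dEven_eq_extend]
    constructor
    · rintro j (h | h) <;> rw [h]
      · exact thetaExponent_injective.extend_apply thetaSign 0 (Sum.inl j)
      · exact thetaExponent_injective.extend_apply thetaSign 0 (Sum.inr j)
    · intro h
      refine Function.extend_apply' _ _ _ ?_
      rintro ⟨j | j, hj⟩
      exacts [h ⟨j, Or.inl hj.symm⟩, h ⟨j, Or.inr hj.symm⟩]
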